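/- Let $(M^{n+1},g_{ab})$, $n\ge 2$, be a spacetime: a smooth $(n+1)$-dimensional manifold with a smooth Lorentzian metric of signature $(-,+,\dots,+)$, time oriented by a smooth vector field that is causal at every point, where a vector $v$ is called causal if $v\neq 0$ and $v^av_a\le 0$ and timelike if $v^av_a<0$. Let $\nabla$ be the Levi-Civita connection. A $k$-dimensional trapped submanifold is a smooth embedded $k$-dimensional submanifold $S\subset M$ without boundary, not necessarily compact, whose induced metric $h_{\alpha\beta}$ is positive definite and whose mean curvature vector field $$H^b=-h^{\alpha\beta}\,(e_\alpha^a\nabla_a e_\beta^b)^\perp$$ is future timelike at every point; here $e_\alpha$ are the coordinate tangent vectors of $S$ and $\perp$ is the component normal to $S$. A closed trapped submanifold is a compact (non-empty) trapped submanifold. Let $g:M\to\mathbb R$ be a $C^2$ function and $Z_g\subset M$ an open set on which the gradient $\nabla^a g$ is future causal. Suppose that at every $p\in Z_g$ the restriction of $\nabla_a\nabla_b g$ to the tangent space $\ker dg_p$ of the $g$-level set through $p$ is positive semidefinite. Then: (i) if $S$ is a trapped submanifold of any dimension, $g|_S$ has no local maximum at a point of $S\cap Z_g$; (ii) no closed trapped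 submanifold of any dimension is contained in $Z_g$. Moreover (for any $C^2$ function $g$ and any open set $Z_g$ on which $\nabla^a g$ is future causal), the following are equivalent: (a) at every $p\in Z_g$ the restriction of $\nabla_a\nabla_b g$ to $\ker dg_p$ is positive semidefinite; (b) at every $p\in Z_g$ and for every spacelike one-dimensional subspace $W\subset\ker dg_p$, the trace of the restriction of $\nabla_a\nabla_b g$ to $W$ (with respect to the induced metric on $W$) is non-negative. -/

import Mathlib

open Set Filter Topology Manifold ContDiff

universe u v

noncomputable section

/-- The model space `ℝᵐ`. -/
abbrev Rn (m : ℕ) : Type := EuclideanSpace ℝ (Fin m)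

/-! ### Linear algebra of scalar products -/

section LinearAlgebra

variable {V : Type*} [AddCommGroup V] [Module ℝ V] [TopologicalSpace V]

/-- A symmetric bilinear form of signature `(-, +, ..., +)`: some vector `t` has `B t t < 0` and
`B` is positive definite on the `B`-orthogonal complement of `t`. -/
def IsLorentzForm (B : V →L[ℝ] V →L[ℝ] ℝ) : Prop :=
  (∀ v w, B v w = B w v) ∧
    ∃ t, B t t < 0 ∧ ∀ v, B t v = 0 → v ≠ 0 → 0 < B v v

/-- A Lorentz form is nondegenerate. -/
theorem IsLorentzForm.eq_zero {B : V →L[ℝ] V →L[ℝ] ℝ} (hB : IsLorentzForm B) {v : V}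
    (hv : ∀ w, B v w = 0) : v = 0 := by
  obtain ⟨hs, t, -, hpos⟩ := hB
  by_contra hne
  have h1 := hpos v (by rw [hs]; exact hv t) hne
  rw [hv v] at h1
  exact lt_irrefl _ h1

/-- On a finite-dimensional space, a Lorentz form identifies covectors with vectors. -/
theorem IsLorentzForm.exists_sharp [FiniteDimensional ℝ V] {B : V →L[ℝ] V →L[ℝ] ℝ}
    (hB : IsLorentzForm B) (α : V →L[ℝ] ℝ) : ∃ v, ∀ w, B v w = α w := by
  let L : V →ₗ[ℝ] Module.Dual ℝ V :=
    { toFun := fun v => (B v : V →ₗ[ℝ] ℝ)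
      map_add' := fun v w => by ext u; simp
      map_smul' := fun c v => by ext u; simp }
  have hinj : Function.Injective L := by
    rw [← LinearMap.ker_eq_bot, LinearMap.ker_eq_bot']
    intro v hv
    exact hB.eq_zero fun w => LinearMap.congr_fun hv w
  have hsurj : Function.Surjective L :=
    (LinearMap.injective_iff_surjective_of_finrank_eq_finrank
      (Subspace.dual_finrank_eq (K := ℝ) (V := V)).symm).1 hinj
  obtain ⟨v, hv⟩ := hsurj (α : V →ₗ[ℝ] ℝ)
  exact ⟨v, fun w => LinearMap.congr_fun hv w⟩

/-- Raising the index of a covector: `IsLorentzForm.sharp hB α` is the vector `v` with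
`B v w = α w` for all `w` (unique by nondegeneracy). -/
def IsLorentzForm.sharp [FiniteDimensional ℝ V] {B : V →L[ℝ] V →L[ℝ] ℝ}
    (hB : IsLorentzForm B) (α : V →L[ℝ] ℝ) : V :=
  Classical.choose (hB.exists_sharp α)

theorem IsLorentzForm.sharp_spec [FiniteDimensional ℝ V] {B : V →L[ℝ] V →L[ℝ] ℝ}
    (hB : IsLorentzForm B) (α : V →L[ℝ] ℝ) (w : V) : B (hB.sharp α) w = α w :=
  Classical.choose_spec (hB.exists_sharp α) w

/-- The matrix `h_{ij} = B (e i) (e j)` of the form induced on the span of `e`. -/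
def inducedMatrix (B : V →L[ℝ] V →L[ℝ] ℝ) {k : ℕ} (e : Fin k → V) : Matrix (Fin k) (Fin k) ℝ :=
  Matrix.of fun i j => B (e i) (e j)

/-- The trace `∑ h^{ij} K i j`, where `h^{ij}` is the inverse of `h_{ij} = B (e i) (e j)`. -/
def inducedTrace (B : V →L[ℝ] V →L[ℝ] ℝ) {k : ℕ} (e : Fin k → V)
    {X : Type*} [AddCommGroup X] [Module ℝ X] (K : Fin k → Fin k → X) : X :=
  ∑ i, ∑ j, (inducedMatrix B e)⁻¹ i j • K i j

/-- The component `v^⊥ = v - h^{ij} B(v, e i) e j` of `v` normal to the span of `e`. -/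
def normalPart (B : V →L[ℝ] V →L[ℝ] ℝ) {k : ℕ} (e : Fin k → V) (v : V) : V :=
  v - inducedTrace B e fun i j => B v (e i) • e j

/-- The linearly independent vectors `e` span a subspace on which `B` is positive definite. -/
def SpansSpacelike (B : V →L[ℝ] V →L[ℝ] ℝ) {k : ℕ} (e : Fin k → V) : Prop :=
  LinearIndependent ℝ e ∧ ∀ v ∈ Submodule.span ℝ (range e), v ≠ 0 → 0 < B v v

/-- Timelike vectors. -/
def IsTimelikeVec (B : V →L[ℝ] V →L[ℝ] ℝ) (v : V) : Prop := B v v < 0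

/-- Causal vectors: nonzero and timelike or null. -/
def IsCausalVec (B : V →L[ℝ] V →L[ℝ] ℝ) (v : V) : Prop := v ≠ 0 ∧ B v v ≤ 0

/-- `v` is causal and lies in the same half cone as the causal vector `o`: either `B v o < 0`, or
`v` is a positive multiple of `o` (the only other possibility, which occurs when `o` is null). -/
def IsFutureCausalVec (B : V →L[ℝ] V →L[ℝ] ℝ) (o v : V) : Prop :=
  IsCausalVec B v ∧ (B v o < 0 ∨ ∃ c : ℝ, 0 < c ∧ v = c • o)

end LinearAlgebra

/-! ### Spacetimes -/

/-- The structure of a spacetime on a smooth `(n+1)`-manifold `M`: a smooth Lorentzian metric and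
a time orientation, given by a smooth everywhere causal vector field. -/
structure Spacetime (n : ℕ) (M : Type*) [TopologicalSpace M] [ChartedSpace (Rn (n + 1)) M]
    [IsManifold (𝓡 (n + 1)) ∞ M] where
  /-- the metric, at each point -/
  metric (p : M) : TangentSpace (𝓡 (n + 1)) p →L[ℝ] TangentSpace (𝓡 (n + 1)) p →L[ℝ] ℝ
  lorentz (p : M) : IsLorentzForm (metric p)
  contMDiff_metric : ContMDiff (𝓡 (n + 1))
    ((𝓡 (n + 1)).prod 𝓘(ℝ, Rn (n + 1) →L[ℝ] Rn (n + 1) →L[ℝ] ℝ)) ∞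
    (fun p : M => Bundle.TotalSpace.mk' (Rn (n + 1) →L[ℝ] Rn (n + 1) →L[ℝ] ℝ)
      (E := fun p : M =>
        TangentSpace (𝓡 (n + 1)) p →L[ℝ] TangentSpace (𝓡 (n + 1)) p →L[ℝ] ℝ) p (metric p))
  /-- the vector field defining the time orientation -/
  orient (p : M) : TangentSpace (𝓡 (n + 1)) p
  contMDiff_orient : ContMDiff (𝓡 (n + 1)) (𝓡 (n + 1)).tangent ∞
    (fun p : M => (⟨p, orient p⟩ : TangentBundle (𝓡 (n + 1)) M))
  causal_orient (p : M) : IsCausalVec (metric p) (orient p)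

namespace Spacetime

variable {n : ℕ} {M : Type*} [TopologicalSpace M] [ChartedSpace (Rn (n + 1)) M]
  [IsManifold (𝓡 (n + 1)) ∞ M] (st : Spacetime n M)

/-- Future causal tangent vectors. -/
def IsFutureCausal (p : M) (v : TangentSpace (𝓡 (n + 1)) p) : Prop :=
  IsFutureCausalVec (st.metric p) (st.orient p) v

/-- Future timelike tangent vectors. -/
def IsFutureTimelike (p : M) (v : TangentSpace (𝓡 (n + 1)) p) : Prop :=
  IsTimelikeVec (st.metric p) v ∧ st.IsFutureCausal p v

/-- The metric at `p` as a form on the model space. -/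
def metricE (p : M) : Rn (n + 1) →L[ℝ] Rn (n + 1) →L[ℝ] ℝ := st.metric p

theorem lorentzE (p : M) : IsLorentzForm (st.metricE p) := st.lorentz p

/-- The components `g_{ab}(y)` of the metric in the preferred chart `φ` at `p`, that is, the
pullback of the metric by `φ⁻¹`, at the point `y` of the model space. -/
def chartMetric (p : M) (y : Rn (n + 1)) : Rn (n + 1) →L[ℝ] Rn (n + 1) →L[ℝ] ℝ :=
  let A : Rn (n + 1) →L[ℝ] Rn (n + 1) :=
    mfderiv (𝓡 (n + 1)) (𝓡 (n + 1)) (extChartAt (𝓡 (n + 1)) p).symm y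
  (st.metricE ((extChartAt (𝓡 (n + 1)) p).symm y)).bilinearComp A A

/-- The derivative at `p` of the metric components in the preferred chart at `p`:
`st.dMetric p u v w` is `u^c v^a w^b ∂_c g_{ab}`. -/
def dMetric (p : M) : Rn (n + 1) →L[ℝ] Rn (n + 1) →L[ℝ] Rn (n + 1) →L[ℝ] ℝ :=
  fderiv ℝ (st.chartMetric p) (extChartAt (𝓡 (n + 1)) p p)

/-- `Γ_{c a b} v^a w^b u^c = (1/2) (∂_a g_{bc} + ∂_b g_{ac} - ∂_c g_{ab}) v^a w^b u^c`, at `p`, in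
the preferred chart at `p`. -/
def christoffelLower (p : M) (v w : Rn (n + 1)) : Rn (n + 1) →L[ℝ] ℝ :=
  (1 / 2 : ℝ) • (st.dMetric p v w + st.dMetric p w v -
    ((st.dMetric p).flip v).flip w)

/-- The Christoffel symbols `Γ^c_{a b} v^a w^b` of the Levi-Civita connection at `p`, in the
preferred chart at `p`. -/
def christoffel (p : M) (v w : Rn (n + 1)) : Rn (n + 1) :=
  (st.lorentzE p).sharp (st.christoffelLower p v w)

/-- The gradient `∇^a f` at `p`. -/
def gradient (f : M → ℝ) (p : M) : TangentSpace (𝓡 (n + 1)) p :=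
  (st.lorentzE p).sharp (mfderiv (𝓡 (n + 1)) 𝓘(ℝ, ℝ) f p : Rn (n + 1) →L[ℝ] ℝ)

/-- The Hessian `v^a w^b ∇_a ∇_b f = v^a w^b (∂_a ∂_b f - Γ^c_{a b} ∂_c f)` at `p`, computed in the
preferred chart at `p`; this is the chart through which Mathlib identifies the tangent space at
`p` with the model space. -/
def hessian (f : M → ℝ) (p : M) (v w : TangentSpace (𝓡 (n + 1)) p) : ℝ :=
  let F : Rn (n + 1) → ℝ := f ∘ (extChartAt (𝓡 (n + 1)) p).symm
  let y : Rn (n + 1) := extChartAt (𝓡 (n + 1)) p p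
  fderiv ℝ (fderiv ℝ F) y v w - fderiv ℝ F y (st.christoffel p v w)

/-- The restriction of `∇∇f` to the tangent spaces `ker df` of the level sets of `f` is positive
semidefinite at all points of `Z`. -/
def HessianPosSemidefOnLevelSets (f : M → ℝ) (Z : Set M) : Prop :=
  ∀ p ∈ Z, ∀ v : TangentSpace (𝓡 (n + 1)) p,
    mfderiv (𝓡 (n + 1)) 𝓘(ℝ, ℝ) f p v = 0 → 0 ≤ st.hessian f p v v

/-- At all points of `Z`, the restriction of `∇∇f` to every spacelike `k`-dimensional subspace
(given by a basis `e`) of the tangent space `ker df` of the level set of `f` has nonnegative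
trace. -/
def HessianTraceNonneg (k : ℕ) (f : M → ℝ) (Z : Set M) : Prop :=
  ∀ p ∈ Z, ∀ e : Fin k → TangentSpace (𝓡 (n + 1)) p, SpansSpacelike (st.metric p) e →
    (∀ i, mfderiv (𝓡 (n + 1)) 𝓘(ℝ, ℝ) f p (e i) = 0) →
    0 ≤ inducedTrace (st.metric p) e fun i j => st.hessian f p (e i) (e j)

/-! ### Submanifolds -/

section Submanifold

variable (k : ℕ) {S : Type*} [TopologicalSpace S] [ChartedSpace (Rn k) S] (Φ : S → M)

/-- The coordinate expression `u ↦ x(u)` of `Φ` in the preferred charts at `s` and `Φ s`. -/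
def coordExpr (s : S) : Rn k → Rn (n + 1) := writtenInExtChartAt (𝓡 k) (𝓡 (n + 1)) s Φ

/-- The `α`-th coordinate vector of `ℝᵏ`. -/
def coordVec {k : ℕ} (α : Fin k) : Rn k := EuclideanSpace.single α 1

/-- The coordinate tangent vectors `e_α^a = ∂x^a/∂u^α` at `s`. -/
def coordFrame (s : S) (α : Fin k) : Rn (n + 1) :=
  fderiv ℝ (coordExpr k Φ s) (extChartAt (𝓡 k) s s) (coordVec α)

/-- `e_α^a ∇_a e_β^b = ∂²x^b/∂u^α∂u^β + Γ^b_{c d} e_α^c e_β^d` at `s`. -/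
def covDerivFrame (s : S) (α β : Fin k) : Rn (n + 1) :=
  fderiv ℝ (fderiv ℝ (coordExpr k Φ s)) (extChartAt (𝓡 k) s s) (coordVec α) (coordVec β) +
    st.christoffel (Φ s) (coordFrame k Φ s α) (coordFrame k Φ s β)

/-- The second fundamental form `II_{αβ} = -(e_α^a ∇_a e_β)^⊥` at `s`. -/
def secondFundamentalForm (s : S) (α β : Fin k) : Rn (n + 1) :=
  - normalPart (st.metricE (Φ s)) (coordFrame k Φ s) (st.covDerivFrame k Φ s α β)

/-- The mean curvature vector `H = h^{αβ} II_{αβ} = -h^{αβ} (e_α^a ∇_a e_β)^⊥` at `s`. -/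
def meanCurvature (s : S) : TangentSpace (𝓡 (n + 1)) (Φ s) :=
  inducedTrace (st.metricE (Φ s)) (coordFrame k Φ s) (st.secondFundamentalForm k Φ s)

/-- `Φ` is the embedding of a smooth `k`-dimensional spacelike submanifold. -/
structure IsSpacelikeSubmanifold : Prop where
  isSmoothEmbedding : IsSmoothEmbedding (𝓡 k) (𝓡 (n + 1)) ∞ Φ
  spacelike : ∀ (s : S) (v : TangentSpace (𝓡 k) s), v ≠ 0 →
    0 < st.metric (Φ s) (mfderiv (𝓡 k) (𝓡 (n + 1)) Φ s v) (mfderiv (𝓡 k) (𝓡 (n + 1)) Φ s v)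

/-- `Φ` is the embedding of a trapped submanifold: a spacelike submanifold whose mean curvature
vector is future timelike at every point. -/
structure IsTrappedSubmanifold : Prop extends st.IsSpacelikeSubmanifold k Φ where
  trapped : ∀ s : S, st.IsFutureTimelike (Φ s) (st.meanCurvature k Φ s)

end Submanifold

end Spacetime

end

/-!
The nonexistence results are a maximum principle. Let `g|_S` have a local maximum at a point
`s ∈ Z` of a trapped submanifold `S` with coordinate frame `e_α`. Then the frame is tangent to the
level set of `g`, and the coordinate Hessian of `g|_S` is
`∂_α ∂_β (g|_S) = e_α^a e_β^b ∇_a ∇_b g + dg(∇_α e_β)`: the Christoffel terms on the right cancel,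
so this is the chain rule (`Spacetime.fderiv_fderiv_restrict`). Taking the trace with respect to the
induced metric, and using that `dg` annihilates tangential components,
`h^{αβ} ∂_α ∂_β (g|_S) = h^{αβ} e_α^a e_β^b ∇_a ∇_b g - g(∇g, H)`.
The left side is nonpositive by the second derivative test
(`IsLocalMax.fderiv_fderiv_nonpos`). On the right, the first term is nonnegative because `∇∇g` is
positive semidefinite on `ker dg` (`Matrix.PosDef.sum_inv_mul_nonneg`), and `g(∇g, H) < 0` because
`∇g` is future causal and `H` future timelike (`IsLorentzForm.neg_of_isFutureCausalVec`). This is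
a contradiction (`Spacetime.IsTrappedSubmanifold.not_isLocalMax`). On a compact `S`, the function
`g|_S` attains its maximum, so `S` cannot lie in `Z`.

For the equivalence with nonnegative traces on spacelike lines, only the vectors `v ∈ ker dg` that
are not spacelike need an argument. The kernel of `dg` is the orthogonal complement of the causal
vector `∇g`, so such a `v`, if nonzero, is a null multiple of `∇g`. In dimension at least three
the complement contains a spacelike `w` independent of `∇g`; the vectors `v + ε w` with `ε ≠ 0`
are spacelike, and `ε → 0` gives the claim (`IsLorentzForm.nonneg_of_nonneg_spacelike`).
-/

/-! ### Lorentzian linear algebra -/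

section LorentzForm

variable {V : Type*} [AddCommGroup V] [Module ℝ V] [TopologicalSpace V]
  {B : V →L[ℝ] V →L[ℝ] ℝ}

/-- A subspace on which a Lorentz form is negative semidefinite has dimension at most one. -/
theorem IsLorentzForm.exists_eq_smul_of_nonpos (hB : IsLorentzForm B) {u v : V}
    (hu : IsCausalVec B u) (hv : B v v ≤ 0) (huv : B u v = 0) : ∃ c : ℝ, v = c • u := by
  obtain ⟨hs, t, -, hpos⟩ := hB
  have htu : B t u ≠ 0 := fun h => absurd (hpos u h hu.1) (not_lt.2 hu.2)
  -- `w` lies both in the span of `u` and `v` and in the positive definite complement of `t`.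
  set w : V := B t v • u - B t u • v with hw
  have h1 : B t w = 0 := by simp only [hw, map_sub, map_smul, smul_eq_mul]; ring
  have h2 : B w w = B t v ^ 2 * B u u + B t u ^ 2 * B v v := by
    simp only [hw, map_sub, map_smul, smul_eq_mul, sub_apply, smul_apply,
      hs v u, huv]
    ring
  have h3 : w = 0 := by
    by_contra hne
    have := hpos w h1 hne
    nlinarith [mul_nonneg (sq_nonneg (B t v)) (neg_nonneg.2 hu.2),
      mul_nonneg (sq_nonneg (B t u)) (neg_nonneg.2 hv)]
  refine ⟨B t v / B t u, ?_⟩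
  rw [div_eq_inv_mul, mul_smul, sub_eq_zero.1 h3, smul_smul, inv_mul_cancel₀ htu, one_smul]

theorem IsLorentzForm.pos_of_orthogonal_timelike (hB : IsLorentzForm B) {u v : V}
    (hu : IsTimelikeVec B u) (huv : B u v = 0) (hv : v ≠ 0) : 0 < B v v := by
  by_contra! h
  have hu0 : u ≠ 0 := by rintro rfl; simp [IsTimelikeVec] at hu
  obtain ⟨c, rfl⟩ := hB.exists_eq_smul_of_nonpos ⟨hu0, hu.le⟩ h huv
  rw [map_smul, smul_eq_mul] at huv
  rcases mul_eq_zero.1 huv with rfl | h0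
  · exact hv (zero_smul _ _)
  · exact hu.ne h0

/-- Two causal vectors in the same half cone as `o`, one of them timelike, have negative product. -/
theorem IsLorentzForm.neg_of_isFutureCausalVec (hB : IsLorentzForm B) {o u v : V}
    (ho : IsCausalVec B o) (hu : IsTimelikeVec B u) (hu' : IsFutureCausalVec B o u)
    (hv : IsFutureCausalVec B o v) : B v u < 0 := by
  have hs := hB.1
  have huo : B u o < 0 := by
    rcases hu'.2 with h | ⟨c, hc, rfl⟩
    · exact h
    · simp only [IsTimelikeVec, map_smul, smul_apply, smul_eq_mul] at hu ⊢
      exact (pos_iff_neg_of_mul_neg hu).1 hc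
  rcases hv.2 with hvo | ⟨c, hc, rfl⟩
  swap
  · simp only [map_smul, smul_apply, smul_eq_mul, hs o u]
    exact mul_neg_of_pos_of_neg hc huo
  by_contra! hvu
  -- If `B v u ≥ 0`, a nonnegative combination of `o` and `v` is orthogonal to `u`. It is not
  -- spacelike, so it vanishes, which contradicts `B v o < 0`.
  set w : V := B v u • o - B u o • v with hw
  have h1 : B u w = 0 := by
    simp only [hw, map_sub, map_smul, smul_eq_mul, hs u v]; ring
  have h2 : B w w = B v u ^ 2 * B o o + B u o ^ 2 * B v v - 2 * (B v u * B u o) * B v o := by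
    simp only [hw, map_sub, map_smul, smul_eq_mul, sub_apply, smul_apply, hs o v]
    ring
  have h3 : B w w ≤ 0 := by
    have e1 := mul_nonneg (sq_nonneg (B v u)) (neg_nonneg.2 ho.2)
    have e2 := mul_nonneg (sq_nonneg (B u o)) (neg_nonneg.2 hv.1.2)
    have e3 := mul_nonneg (mul_nonneg hvu (neg_nonneg.2 huo.le)) (neg_nonneg.2 hvo.le)
    rw [h2]; linarith
  have h4 : w = 0 := by
    by_contra hne
    exact absurd (hB.pos_of_orthogonal_timelike hu h1 hne) (not_lt.2 h3)
  have h5 : B w o = B v u * B o o - B u o * B v o := by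
    simp only [hw, map_sub, map_smul, smul_eq_mul, sub_apply, smul_apply]
  rw [h4, map_zero, zero_apply] at h5
  have e1 := mul_nonneg hvu (neg_nonneg.2 ho.2)
  have e2 := mul_pos (neg_pos.2 huo) (neg_pos.2 hvo)
  linarith

theorem IsLorentzForm.eq_sharp [FiniteDimensional ℝ V] (hB : IsLorentzForm B) {α : V →L[ℝ] ℝ}
    {v : V} (hv : ∀ w, B v w = α w) : v = hB.sharp α :=
  sub_eq_zero.1 <| hB.eq_zero fun w => by
    rw [map_sub, sub_apply, hv, hB.sharp_spec, sub_self]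

theorem IsLorentzForm.sharp_add [FiniteDimensional ℝ V] (hB : IsLorentzForm B)
    (α β : V →L[ℝ] ℝ) : hB.sharp (α + β) = hB.sharp α + hB.sharp β :=
  (hB.eq_sharp fun w => by simp only [map_add, add_apply, hB.sharp_spec]).symm

theorem IsLorentzForm.sharp_smul [FiniteDimensional ℝ V] (hB : IsLorentzForm B)
    (c : ℝ) (α : V →L[ℝ] ℝ) : hB.sharp (c • α) = c • hB.sharp α :=
  (hB.eq_sharp fun w => by simp only [map_smul, smul_apply, hB.sharp_spec]).symm

/-- If a form is nonnegative on the spacelike vectors of the orthogonal complement of a causal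
vector, it is nonnegative on the whole complement: in dimension at least three, the remaining
vectors are limits of spacelike ones. -/
theorem IsLorentzForm.nonneg_of_nonneg_spacelike [FiniteDimensional ℝ V]
    (hB : IsLorentzForm B) (hdim : 3 ≤ Module.finrank ℝ V) (Q : V →ₗ[ℝ] V →ₗ[ℝ] ℝ) {u : V}
    (hu : IsCausalVec B u) (hQ : ∀ v, B u v = 0 → 0 < B v v → 0 ≤ Q v v) {v : V}
    (huv : B u v = 0) : 0 ≤ Q v v := by
  rcases lt_or_ge 0 (B v v) with h | h
  · exact hQ v huv h
  obtain ⟨c, rfl⟩ := hB.exists_eq_smul_of_nonpos hu h huv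
  rcases eq_or_ne c 0 with rfl | hc
  · simp
  have huu : B u u = 0 := by
    rw [map_smul, smul_eq_mul] at huv
    exact (mul_eq_zero.1 huv).resolve_left hc
  obtain ⟨w, huw, hw⟩ : ∃ w, B u w = 0 ∧ w ∉ Submodule.span ℝ {u} := by
    by_contra! hcon
    -- Otherwise the kernel of `B u` would have dimension at most one, not at least two.
    have hle : LinearMap.ker (B u : V →ₗ[ℝ] ℝ) ≤ Submodule.span ℝ {u} := fun w hw => hcon w hw
    have h1 := Submodule.finrank_mono hle
    have h2 := finrank_span_singleton (K := ℝ) hu.1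
    have h3 := (B u : V →ₗ[ℝ] ℝ).finrank_range_add_finrank_ker
    have h4 := Submodule.finrank_le (LinearMap.range (B u : V →ₗ[ℝ] ℝ))
    rw [Module.finrank_self] at h4
    omega
  have hww : 0 < B w w := by
    by_contra! h'
    obtain ⟨d, rfl⟩ := hB.exists_eq_smul_of_nonpos hu h' huw
    exact hw (Submodule.smul_mem _ _ (Submodule.mem_span_singleton_self u))
  have hlim : Tendsto (fun ε : ℝ => Q (c • u + ε • w) (c • u + ε • w)) (𝓝[≠] 0)
      (𝓝 (Q (c • u) (c • u))) := by
    have hc : Continuous fun ε : ℝ => Q (c • u + ε • w) (c • u + ε • w) := by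
      simp only [map_add, map_smul, LinearMap.add_apply, LinearMap.smul_apply, smul_eq_mul]
      fun_prop
    have := hc.tendsto 0
    simp only [zero_smul, add_zero] at this
    exact this.mono_left nhdsWithin_le_nhds
  refine ge_of_tendsto hlim ?_
  filter_upwards [self_mem_nhdsWithin] with ε hε
  refine hQ _ ?_ ?_
  · simp only [map_add, map_smul, huu, huw, smul_zero, add_zero]
  · have : B (c • u + ε • w) (c • u + ε • w) = ε ^ 2 * B w w := by
      simp only [map_add, map_smul, add_apply, smul_apply, hB.1 w u, huu, huw, smul_eq_mul]
      ring
    rw [this]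
    have : ε ≠ 0 := hε
    positivity

end LorentzForm

/-! ### Traces with respect to the induced metric -/

/-- The pairing of a positive definite matrix with a matrix whose quadratic form is nonnegative is
nonnegative; the second matrix need not be symmetric. -/
theorem Matrix.PosDef.sum_inv_mul_nonneg {k : ℕ} {h K : Matrix (Fin k) (Fin k) ℝ} (hh : h.PosDef)
    (hK : ∀ x : Fin k → ℝ, 0 ≤ ∑ i, ∑ j, x i * x j * K i j) :
    0 ≤ ∑ i, ∑ j, h⁻¹ i j * K i j := by
  obtain ⟨m, C, hC⟩ := Matrix.posSemidef_iff_eq_sum_vecMulVec.1 hh.inv.posSemidef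
  have : ∑ i, ∑ j, h⁻¹ i j * K i j = ∑ m, ∑ i, ∑ j, C m i * C m j * K i j := by
    simp only [hC, Matrix.sum_apply, Matrix.vecMulVec_apply, star_trivial,
      Finset.sum_mul]
    rw [Finset.sum_comm]
    refine (Finset.sum_congr rfl fun i _ => Finset.sum_comm).trans ?_
    rw [Finset.sum_comm]
    exact Finset.sum_congr rfl fun i _ => Finset.sum_comm
  rw [this]
  exact Finset.sum_nonneg fun m _ => hK (C m)

section InducedTrace

variable {V : Type*} [AddCommGroup V] [Module ℝ V] [TopologicalSpace V]
  {B : V →L[ℝ] V →L[ℝ] ℝ} {k : ℕ} {e : Fin k → V}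

theorem posDef_inducedMatrix (hs : ∀ v w, B v w = B w v)
    (he : ∀ x : Fin k → ℝ, x ≠ 0 → 0 < B (∑ i, x i • e i) (∑ i, x i • e i)) :
    (inducedMatrix B e).PosDef := by
  refine Matrix.PosDef.of_dotProduct_mulVec_pos ?_ fun x hx => ?_
  · ext i j
    simp [inducedMatrix, hs (e j) (e i)]
  · refine (he x hx).trans_eq ?_
    simp only [inducedMatrix, dotProduct, Matrix.mulVec, Matrix.of_apply, star_trivial, map_sum,
      map_smul, sum_apply, smul_apply, smul_eq_mul, Finset.mul_sum]
    rw [Finset.sum_comm]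
    exact Finset.sum_congr rfl fun i _ => Finset.sum_congr rfl fun j _ => by ring

theorem inducedTrace_nonneg (hh : (inducedMatrix B e).PosDef) {K : Fin k → Fin k → ℝ}
    (hK : ∀ x : Fin k → ℝ, 0 ≤ ∑ i, ∑ j, x i * x j * K i j) : 0 ≤ inducedTrace B e K :=
  hh.sum_inv_mul_nonneg (K := Matrix.of K) hK

theorem inducedTrace_add {X : Type*} [AddCommGroup X] [Module ℝ X] (K L : Fin k → Fin k → X) :
    inducedTrace B e (fun i j => K i j + L i j) = inducedTrace B e K + inducedTrace B e L := by
  simp only [inducedTrace, smul_add, Finset.sum_add_distrib]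

theorem inducedTrace_neg {X : Type*} [AddCommGroup X] [Module ℝ X] (K : Fin k → Fin k → X) :
    inducedTrace B e (fun i j => -K i j) = -inducedTrace B e K := by
  simp only [inducedTrace, smul_neg, Finset.sum_neg_distrib]

theorem map_inducedTrace {X Y : Type*} [AddCommGroup X] [Module ℝ X] [AddCommGroup Y] [Module ℝ Y]
    (α : X →ₗ[ℝ] Y) (K : Fin k → Fin k → X) :
    α (inducedTrace B e K) = inducedTrace B e fun i j => α (K i j) := by
  simp only [inducedTrace, map_sum, map_smul]

/-- A covector that vanishes on the span of `e` does not see tangential components. -/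
theorem map_normalPart (α : V →ₗ[ℝ] ℝ) (hα : ∀ i, α (e i) = 0) (v : V) :
    α (normalPart B e v) = α v := by
  rw [normalPart, map_sub, map_inducedTrace]
  simp [inducedTrace, hα]

/-- The quadratic form of a bilinear form on the span of `e`, in coordinates. -/
theorem sum_sum_mul_apply {V : Type*} [AddCommGroup V] [Module ℝ V] (Q : V →ₗ[ℝ] V →ₗ[ℝ] ℝ)
    (e : Fin k → V) (x : Fin k → ℝ) :
    ∑ i, ∑ j, x i * x j * Q (e i) (e j) = Q (∑ i, x i • e i) (∑ i, x i • e i) := by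
  simp only [map_sum, map_smul, LinearMap.sum_apply, LinearMap.smul_apply, smul_eq_mul,
    Finset.mul_sum]
  rw [Finset.sum_comm]
  exact Finset.sum_congr rfl fun i _ => Finset.sum_congr rfl fun j _ => by ring

end InducedTrace

/-! ### Second derivatives -/

section SecondDerivative

variable {E F : Type*} [NormedAddCommGroup E] [NormedSpace ℝ E] [NormedAddCommGroup F]
  [NormedSpace ℝ F]

/-- The second derivative test, as a necessary condition. -/
theorem IsLocalMax.fderiv_fderiv_nonpos {f : E → ℝ} {a : E} (hmax : IsLocalMax f a)
    (hf : ContDiffAt ℝ 2 f a) (v : E) : fderiv ℝ (fderiv ℝ f) a v v ≤ 0 := by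
  by_contra! hpos
  let l : ℝ → E := fun t => a + t • v
  have hl : ∀ t, HasDerivAt l v t := fun t => by
    simpa only [id, one_smul] using ((hasDerivAt_id t).smul_const v).const_add a
  have hl0 : l 0 = a := by simp [l]
  have hlc : Tendsto l (𝓝 0) (𝓝 a) := by
    simpa only [hl0] using (hl 0).continuousAt.tendsto
  have hdf : ∀ᶠ x in 𝓝 a, DifferentiableAt ℝ f x :=
    (hf.eventually (by simp)).mono fun x hx => hx.differentiableAt (by norm_num)
  have h1 : deriv (f ∘ l) =ᶠ[𝓝 0] fun t => fderiv ℝ f (l t) v := by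
    filter_upwards [hlc.eventually hdf] with t ht
    exact (ht.hasFDerivAt.comp_hasDerivAt t (hl t)).deriv
  have h2 : deriv (deriv (f ∘ l)) 0 = fderiv ℝ (fderiv ℝ f) a v v := by
    rw [h1.deriv_eq]
    have hd : DifferentiableAt ℝ (fderiv ℝ f) (l 0) := by
      rw [hl0]
      exact (hf.fderiv_right (m := 1) (by norm_num)).differentiableAt (by norm_num)
    have := (hd.hasFDerivAt.comp_hasDerivAt 0 (hl 0)).clm_apply (hasDerivAt_const 0 v)
    simpa [hl0] using this.deriv
  have hmax' : IsLocalMax (f ∘ l) 0 := by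
    have : ∀ᶠ t in 𝓝 (0 : ℝ), f (l t) ≤ f a := hlc.eventually hmax
    simpa only [IsLocalMax, IsMaxFilter, Function.comp, hl0] using this
  have hmin : IsLocalMin (f ∘ l) 0 := by
    refine isLocalMin_of_deriv_deriv_pos (h2 ▸ hpos) hmax'.deriv_eq_zero ?_
    exact ContinuousAt.comp (by rw [hl0]; exact hf.continuousAt) (hl 0).continuousAt
  -- A local maximum that is a local minimum forces the function to be locally constant.
  have hconst : f ∘ l =ᶠ[𝓝 0] fun _ => (f ∘ l) 0 := by
    filter_upwards [hmax', hmin] with t h h' using le_antisymm h h'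
  have : deriv (deriv (f ∘ l)) 0 = 0 := by
    rw [hconst.deriv.deriv_eq]; simp
  exact hpos.ne' (h2 ▸ this)

/-- The chain rule for second derivatives. -/
theorem fderiv_fderiv_comp {f : F → ℝ} {x : E → F} {a : E} (hf : ContDiffAt ℝ 2 f (x a))
    (hx : ContDiffAt ℝ 2 x a) (v w : E) :
    fderiv ℝ (fderiv ℝ (f ∘ x)) a v w =
      fderiv ℝ (fderiv ℝ f) (x a) (fderiv ℝ x a v) (fderiv ℝ x a w) +
        fderiv ℝ f (x a) (fderiv ℝ (fderiv ℝ x) a v w) := by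
  have hdf : ∀ᶠ y in 𝓝 (x a), DifferentiableAt ℝ f y :=
    (hf.eventually (by simp)).mono fun y hy => hy.differentiableAt (by norm_num)
  have hdx : ∀ᶠ y in 𝓝 a, DifferentiableAt ℝ x y :=
    (hx.eventually (by simp)).mono fun y hy => hy.differentiableAt (by norm_num)
  have h1 : fderiv ℝ (f ∘ x) =ᶠ[𝓝 a] fun y => (fderiv ℝ f (x y)).comp (fderiv ℝ x y) := by
    filter_upwards [hx.continuousAt.tendsto.eventually hdf, hdx] with y hy hy'
    exact fderiv_comp y hy hy'
  have hf2 : DifferentiableAt ℝ (fderiv ℝ f) (x a) :=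
    (hf.fderiv_right (m := 1) (by norm_num)).differentiableAt (by norm_num)
  have hx2 : DifferentiableAt ℝ (fderiv ℝ x) a :=
    (hx.fderiv_right (m := 1) (by norm_num)).differentiableAt (by norm_num)
  have h2 := (hf2.hasFDerivAt.comp a (hx.differentiableAt (by norm_num)).hasFDerivAt).clm_comp
    hx2.hasFDerivAt
  rw [h1.fderiv_eq,
    show fderiv ℝ (fun y => (fderiv ℝ f (x y)).comp (fderiv ℝ x y)) a = _ from h2.fderiv]
  simp [add_comm]

end SecondDerivative

/-! ### Coordinate expressions -/

namespace Spacetime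

section Charts

variable {n : ℕ} {M : Type*} [TopologicalSpace M] [ChartedSpace (Rn (n + 1)) M]

/-- The differential of `f` at `p` as a covector on the model space. -/
noncomputable def differentialE (f : M → ℝ) (p : M) : Rn (n + 1) →L[ℝ] ℝ :=
  mfderiv (𝓡 (n + 1)) 𝓘(ℝ, ℝ) f p

theorem differentialE_eq_fderiv {f : M → ℝ} {p : M}
    (hf : MDifferentiableAt (𝓡 (n + 1)) 𝓘(ℝ, ℝ) f p) :
    differentialE f p =
      fderiv ℝ (f ∘ (extChartAt (𝓡 (n + 1)) p).symm) (extChartAt (𝓡 (n + 1)) p p) := by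
  rw [differentialE, hf.mfderiv, ModelWithCorners.range_eq_univ, fderivWithin_univ]
  rfl

theorem contDiffAt_comp_chart_symm {f : M → ℝ} {p : M}
    (hf : ContMDiffAt (𝓡 (n + 1)) 𝓘(ℝ, ℝ) 2 f p) :
    ContDiffAt ℝ 2 (f ∘ (extChartAt (𝓡 (n + 1)) p).symm) (extChartAt (𝓡 (n + 1)) p p) := by
  have h := (contMDiffAt_iff.1 hf).2
  rwa [ModelWithCorners.range_eq_univ, contDiffWithinAt_univ] at h

variable {k : ℕ} {S : Type*} [TopologicalSpace S] [ChartedSpace (Rn k) S] {Φ : S → M} {s : S}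

theorem contDiffAt_coordExpr (hΦ : ContMDiffAt (𝓡 k) (𝓡 (n + 1)) 2 Φ s) :
    ContDiffAt ℝ 2 (coordExpr (n := n) k Φ s) (extChartAt (𝓡 k) s s) := by
  have h := (contMDiffAt_iff.1 hΦ).2
  rwa [ModelWithCorners.range_eq_univ, contDiffWithinAt_univ] at h

theorem coordExpr_apply_self :
    coordExpr k Φ s (extChartAt (𝓡 k) s s) = extChartAt (𝓡 (n + 1)) (Φ s) (Φ s) := by
  simp [coordExpr, writtenInExtChartAt]

theorem mfderiv_eq_fderiv_coordExpr (hΦ : MDifferentiableAt (𝓡 k) (𝓡 (n + 1)) Φ s) :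
    mfderiv (𝓡 k) (𝓡 (n + 1)) Φ s =
      fderiv ℝ (coordExpr k Φ s) (extChartAt (𝓡 k) s s) := by
  rw [hΦ.mfderiv, ModelWithCorners.range_eq_univ, fderivWithin_univ]
  rfl

theorem sum_smul_coordVec (x : Fin k → ℝ) : ∑ i, x i • coordVec i = WithLp.toLp 2 x := by
  ext j
  simp [coordVec, Finset.sum_apply, Pi.single_apply]

theorem fderiv_coordExpr_toLp (x : Fin k → ℝ) :
    fderiv ℝ (coordExpr k Φ s) (extChartAt (𝓡 k) s s) (WithLp.toLp 2 x) =
      ∑ i, x i • coordFrame (n := n) k Φ s i := by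
  simp only [← sum_smul_coordVec, map_sum, map_smul, coordFrame]

/-- The restriction of `g` to a submanifold, in coordinates, near a point. -/
theorem comp_chart_symm_eventuallyEq (hΦ : ContinuousAt Φ s) (g : M → ℝ) :
    (g ∘ (extChartAt (𝓡 (n + 1)) (Φ s)).symm) ∘ coordExpr k Φ s
      =ᶠ[𝓝 (extChartAt (𝓡 k) s s)] (g ∘ Φ) ∘ (extChartAt (𝓡 k) s).symm := by
  have h1 : ∀ᶠ u in 𝓝 (extChartAt (𝓡 k) s s),
      Φ ((extChartAt (𝓡 k) s).symm u) ∈ (extChartAt (𝓡 (n + 1)) (Φ s)).source := by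
    have hc : Tendsto (fun u => Φ ((extChartAt (𝓡 k) s).symm u)) (𝓝 (extChartAt (𝓡 k) s s))
        (𝓝 (Φ s)) := by
      have h := continuousAt_extChartAt_symm (I := 𝓡 k) s
      rw [ContinuousAt, extChartAt_to_inv] at h
      exact hΦ.tendsto.comp h
    exact hc.eventually (extChartAt_source_mem_nhds (Φ s))
  filter_upwards [h1] with u hu
  simp only [coordExpr, writtenInExtChartAt, Function.comp_apply]
  rw [PartialEquiv.left_inv _ hu]

end Charts

/-! ### Hessians and second fundamental forms -/

variable {n : ℕ} {M : Type*} [TopologicalSpace M] [ChartedSpace (Rn (n + 1)) M]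
  [IsManifold (𝓡 (n + 1)) ∞ M] (st : Spacetime n M)

theorem metricE_gradient (f : M → ℝ) (p : M) (w : Rn (n + 1)) :
    st.metricE p (st.gradient f p) w = differentialE f p w :=
  (st.lorentzE p).sharp_spec _ w

theorem christoffel_add_left (p : M) (v v' w : Rn (n + 1)) :
    st.christoffel p (v + v') w = st.christoffel p v w + st.christoffel p v' w := by
  rw [christoffel, christoffel, christoffel, ← IsLorentzForm.sharp_add]
  congr 1
  ext u
  simp [christoffelLower]
  ring

theorem christoffel_smul_left (p : M) (c : ℝ) (v w : Rn (n + 1)) :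
    st.christoffel p (c • v) w = c • st.christoffel p v w := by
  rw [christoffel, christoffel, ← IsLorentzForm.sharp_smul]
  congr 1
  ext u
  simp [christoffelLower]
  ring

theorem christoffel_add_right (p : M) (v w w' : Rn (n + 1)) :
    st.christoffel p v (w + w') = st.christoffel p v w + st.christoffel p v w' := by
  rw [christoffel, christoffel, christoffel, ← IsLorentzForm.sharp_add]
  congr 1
  ext u
  simp [christoffelLower]
  ring

theorem christoffel_smul_right (p : M) (c : ℝ) (v w : Rn (n + 1)) :
    st.christoffel p v (c • w) = c • st.christoffel p v w := by
  rw [christoffel, christoffel, ← IsLorentzForm.sharp_smul]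
  congr 1
  ext u
  simp [christoffelLower]
  ring

/-- The Hessian of `f` at `p` as a bilinear form on the model space, to which every tangent space
is definitionally equal. Symmetry is not needed. -/
noncomputable def hessianForm (f : M → ℝ) (p : M) : Rn (n + 1) →ₗ[ℝ] Rn (n + 1) →ₗ[ℝ] ℝ :=
  LinearMap.mk₂ ℝ (fun v w => st.hessian f p v w)
    (fun v v' w => by simp only [hessian, christoffel_add_left, map_add, add_apply]; ring)
    (fun c v w => by
      simp only [hessian, christoffel_smul_left, map_smul, smul_apply, smul_eq_mul]; ring)
    (fun v w w' => by simp only [hessian, christoffel_add_right, map_add]; ring)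
    (fun c v w => by simp only [hessian, christoffel_smul_right, map_smul, smul_eq_mul]; ring)

theorem hessianForm_apply (f : M → ℝ) (p : M) (v w : Rn (n + 1)) :
    st.hessianForm f p v w = st.hessian f p v w := rfl

section Submanifold

variable {k : ℕ} {S : Type*} [TopologicalSpace S] [ChartedSpace (Rn k) S] {Φ : S → M} {s : S}

variable {st} in
theorem IsSpacelikeSubmanifold.posDef_inducedMatrix (hS : st.IsSpacelikeSubmanifold k Φ) (s : S) :
    (inducedMatrix (st.metricE (Φ s)) (coordFrame k Φ s)).PosDef := by
  refine _root_.posDef_inducedMatrix (st.lorentzE (Φ s)).1 fun x hx => ?_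
  have hd : MDifferentiableAt (𝓡 k) (𝓡 (n + 1)) Φ s :=
    hS.isSmoothEmbedding.contMDiff.mdifferentiable (by simp) s
  have h := hS.spacelike s (WithLp.toLp 2 x)
    fun h0 => hx ((WithLp.toLp_eq_zero 2).1 h0)
  rw [mfderiv_eq_fderiv_coordExpr hd] at h
  rw [← fderiv_coordExpr_toLp]
  exact h

/-- The Gauss formula for functions: the coordinate Hessian of `g|_S` at a point is the Hessian of
`g` along the frame plus `dg(∇_α e_β)`; the Christoffel terms cancel. -/
theorem fderiv_fderiv_restrict {g : M → ℝ} (hg : ContMDiff (𝓡 (n + 1)) 𝓘(ℝ, ℝ) 2 g)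
    (hΦ : ContMDiffAt (𝓡 k) (𝓡 (n + 1)) 2 Φ s) (α β : Fin k) :
    fderiv ℝ (fderiv ℝ ((g ∘ (extChartAt (𝓡 (n + 1)) (Φ s)).symm) ∘ coordExpr k Φ s))
        (extChartAt (𝓡 k) s s) (coordVec α) (coordVec β) =
      st.hessian g (Φ s) (coordFrame k Φ s α) (coordFrame k Φ s β) +
        differentialE g (Φ s) (st.covDerivFrame k Φ s α β) := by
  have hx := contDiffAt_coordExpr hΦ
  have hF := contDiffAt_comp_chart_symm (hg.contMDiffAt (x := Φ s))
  rw [← coordExpr_apply_self (k := k)] at hF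
  rw [fderiv_fderiv_comp hF hx, differentialE_eq_fderiv (hg.mdifferentiable (by simp) (Φ s)),
    covDerivFrame, map_add, coordExpr_apply_self]
  unfold hessian coordFrame
  ring

/-- `dg(H) = -h^{αβ} dg(∇_α e_β)` when `S` is tangent to the level set of `g`. -/
theorem differentialE_meanCurvature (g : M → ℝ)
    (hker : ∀ α, differentialE g (Φ s) (coordFrame (n := n) k Φ s α) = 0) :
    differentialE g (Φ s) (st.meanCurvature k Φ s) =
      -inducedTrace (st.metricE (Φ s)) (coordFrame k Φ s) fun α β =>
        differentialE g (Φ s) (st.covDerivFrame k Φ s α β) := by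
  let L : Rn (n + 1) →ₗ[ℝ] ℝ := (differentialE (n := n) g (Φ s)).toLinearMap
  refine (map_inducedTrace L _).trans ?_
  rw [← inducedTrace_neg]
  simp only [secondFundamentalForm, map_neg, map_normalPart L hker]
  rfl

/-- The maximum principle: at a local maximum of `g|_S` the trace of the coordinate Hessian of
`g|_S` is nonpositive, but it is the sum of the trace of `∇∇g`, which is nonnegative, and of
`-g(∇g, H)`, which is positive. -/
theorem IsTrappedSubmanifold.not_isLocalMax {st : Spacetime n M} {g : M → ℝ}
    (hg : ContMDiff (𝓡 (n + 1)) 𝓘(ℝ, ℝ) 2 g) {Z : Set M}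
    (hgrad : ∀ p ∈ Z, st.IsFutureCausal p (st.gradient g p))
    (hess : st.HessianPosSemidefOnLevelSets g Z) (hS : st.IsTrappedSubmanifold k Φ)
    (hs : Φ s ∈ Z) : ¬ IsLocalMax (g ∘ Φ) s := by
  intro hmax
  have hΦ : ContMDiffAt (𝓡 k) (𝓡 (n + 1)) 2 Φ s :=
    hS.isSmoothEmbedding.contMDiff.contMDiffAt.of_le
      (WithTop.coe_le_coe.2 le_top)
  set u₀ := extChartAt (𝓡 k) s s with hu₀
  set G : Rn k → ℝ := (g ∘ (extChartAt (𝓡 (n + 1)) (Φ s)).symm) ∘ coordExpr k Φ s with hG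
  have hx := contDiffAt_coordExpr hΦ
  have hF := contDiffAt_comp_chart_symm (hg.contMDiffAt (x := Φ s))
  rw [← coordExpr_apply_self (k := k)] at hF
  have hGmax : IsLocalMax G u₀ := by
    have h := continuousAt_extChartAt_symm (I := 𝓡 k) s
    rw [ContinuousAt, extChartAt_to_inv] at h
    have h1 : IsLocalMax ((g ∘ Φ) ∘ (extChartAt (𝓡 k) s).symm) u₀ := by
      have : ∀ᶠ u in 𝓝 u₀, (g ∘ Φ) ((extChartAt (𝓡 k) s).symm u) ≤ (g ∘ Φ) s :=
        h.eventually hmax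
      simpa [IsLocalMax, IsMaxFilter, u₀] using this
    exact h1.congr (comp_chart_symm_eventuallyEq hΦ.continuousAt g).symm
  have hker : ∀ α, differentialE g (Φ s) (coordFrame (n := n) k Φ s α) = 0 := fun α => by
    have h := congrArg (fun l => l (coordVec α)) hGmax.fderiv_eq_zero
    simp only [hG] at h
    rw [fderiv_comp _ (hF.differentiableAt (by norm_num)) (hx.differentiableAt (by norm_num)),
      coordExpr_apply_self] at h
    rwa [differentialE_eq_fderiv (hg.mdifferentiable (by simp) (Φ s))]
  have hpd := hS.toIsSpacelikeSubmanifold.posDef_inducedMatrix s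
  set B := st.metricE (Φ s)
  set e := coordFrame (n := n) k Φ s
  have h1 : 0 ≤ inducedTrace B e fun α β => st.hessian g (Φ s) (e α) (e β) := by
    refine inducedTrace_nonneg hpd fun x => ?_
    simp only [← hessianForm_apply]
    rw [sum_sum_mul_apply (st.hessianForm g (Φ s)) e x]
    refine hess _ hs _ ?_
    change differentialE g (Φ s) (∑ i, x i • e i) = 0
    simp [hker, e]
  have h2 : 0 ≤ inducedTrace B e fun α β =>
      -fderiv ℝ (fderiv ℝ G) u₀ (coordVec α) (coordVec β) := by
    refine inducedTrace_nonneg hpd fun x => ?_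
    have hGc : ContDiffAt ℝ 2 G u₀ := hF.comp u₀ hx
    let Q : Rn k →ₗ[ℝ] Rn k →ₗ[ℝ] ℝ :=
      LinearMap.mk₂ ℝ (fun v w => fderiv ℝ (fderiv ℝ G) u₀ v w) (by simp) (by simp) (by simp)
        (by simp)
    have hQ := sum_sum_mul_apply Q coordVec x
    have h := hGmax.fderiv_fderiv_nonpos hGc (∑ i, x i • coordVec i)
    simp only [mul_neg, Finset.sum_neg_distrib]
    exact neg_nonneg.2 (hQ.trans_le h)
  have h3 : differentialE (n := n) g (Φ s) (st.meanCurvature k Φ s) < 0 := by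
    have h := (st.lorentzE (Φ s)).neg_of_isFutureCausalVec (st.causal_orient (Φ s))
      (hS.trapped s).1 (hS.trapped s).2 (hgrad _ hs)
    exact (st.metricE_gradient g (Φ s) _).symm.trans_lt h
  have h4 := st.differentialE_meanCurvature g hker
  simp only [hG, hu₀, st.fderiv_fderiv_restrict hg hΦ] at h2
  rw [inducedTrace_neg, inducedTrace_add] at h2
  rw [h4] at h3
  linarith

end Submanifold

/-! ### Spacelike lines in the tangent spaces of the level sets -/

theorem inducedTrace_fin_one {V : Type*} [AddCommGroup V] [Module ℝ V] [TopologicalSpace V]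
    (B : V →L[ℝ] V →L[ℝ] ℝ) (e : Fin 1 → V) (K : Fin 1 → Fin 1 → ℝ) :
    inducedTrace B e K = (B (e 0) (e 0))⁻¹ * K 0 0 := by
  simp [inducedTrace, inducedMatrix]

/-- Spacelike lines detect the sign of `∇∇g` on `ker dg` because, in dimension at least three, null
vectors of `ker dg` are limits of spacelike ones. -/
theorem hessianPosSemidef_iff_hessianTraceNonneg_one (hn : 2 ≤ n) {g : M → ℝ} {Z : Set M}
    (hgrad : ∀ p ∈ Z, st.IsFutureCausal p (st.gradient g p)) :
    st.HessianPosSemidefOnLevelSets g Z ↔ st.HessianTraceNonneg 1 g Z := by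
  constructor
  · intro h p hp e he hker
    rw [inducedTrace_fin_one]
    have hpos := he.2 (e 0) (Submodule.subset_span (mem_range_self 0)) (he.1.ne_zero 0)
    exact mul_nonneg (inv_nonneg.2 hpos.le) (h p hp _ (hker 0))
  · intro h p hp v hv
    refine (st.lorentzE p).nonneg_of_nonneg_spacelike (by simp; omega) (st.hessianForm g p)
      (hgrad p hp).1 (fun w hw hww => ?_) ((st.metricE_gradient g p v).trans hv)
    have hw0 : w ≠ 0 := by rintro rfl; simp at hww
    have hsp : SpansSpacelike (st.metricE p) fun _ : Fin 1 => w := by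
      refine ⟨LinearIndependent.of_subsingleton 0 hw0, fun x hx hx0 => ?_⟩
      rw [range_const, Submodule.mem_span_singleton] at hx
      obtain ⟨c, rfl⟩ := hx
      have hc : c ≠ 0 := by rintro rfl; simp at hx0
      simp only [map_smul, smul_apply, smul_eq_mul, ← mul_assoc]
      exact mul_pos (mul_self_pos.2 hc) hww
    have h1 := h p hp (fun _ => w) hsp fun _ => (st.metricE_gradient g p w).symm.trans hw
    exact nonneg_of_mul_nonneg_right (h1.trans_eq (inducedTrace_fin_one _ _ _)) (inv_pos.2 hww)

end Spacetime

theorem mainTheorem2 {n : ℕ} (hn : 2 ≤ n)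
    {M : Type u} [TopologicalSpace M] [ChartedSpace (Rn (n + 1)) M]
    [IsManifold (𝓡 (n + 1)) ∞ M] (st : Spacetime n M)
    (g : M → ℝ) (hg : ContMDiff (𝓡 (n + 1)) 𝓘(ℝ, ℝ) 2 g)
    (Z : Set M) (hZ : IsOpen Z)
    (hgrad : ∀ p ∈ Z, st.IsFutureCausal p (st.gradient g p)) :
    (st.HessianPosSemidefOnLevelSets g Z →
      (∀ (k : ℕ) (S : Type v) [TopologicalSpace S] [ChartedSpace (Rn k) S]
        [IsManifold (𝓡 k) ∞ S] (Φ : S → M), st.IsTrappedSubmanifold k Φ →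
          ¬ ∃ s : S, Φ s ∈ Z ∧ IsLocalMax (g ∘ Φ) s) ∧
      (∀ (k : ℕ) (S : Type v) [TopologicalSpace S] [ChartedSpace (Rn k) S]
        [IsManifold (𝓡 k) ∞ S] [CompactSpace S] [Nonempty S] (Φ : S → M),
          st.IsTrappedSubmanifold k Φ → ¬ range Φ ⊆ Z)) ∧
    (st.HessianPosSemidefOnLevelSets g Z ↔ st.HessianTraceNonneg 1 g Z) := by
  refine ⟨fun hess => ⟨?_, ?_⟩, st.hessianPosSemidef_iff_hessianTraceNonneg_one hn hgrad⟩
  · rintro k S _ _ _ Φ hS ⟨s, hs, hmax⟩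
    exact hS.not_isLocalMax hg hgrad hess hs hmax
  · intro k S _ _ _ _ _ Φ hS hZS
    have hc : Continuous (g ∘ Φ) := hg.continuous.comp hS.isSmoothEmbedding.contMDiff.continuous
    obtain ⟨s, -, hs⟩ := isCompact_univ.exists_isMaxOn univ_nonempty hc.continuousOn
    exact hS.not_isLocalMax hg hgrad hess (hZS (mem_range_self s))
      (hs.isLocalMax univ_mem)
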